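/- \textbf{Diagrams and state sum.} Let $D$ be an oriented link diagram in the plane whose underlying 4-regular plane graph is connected and has at least one crossing. Its faces are the connected components of the complement of the graph. At each crossing $\chi$ let $F_0^\chi$ be the face at the angle between the two incoming ends, and $F_1^\chi,F_2^\chi,F_3^\chi$ the faces at the other three angles in counterclockwise order (the four faces need not be distinct). A state $\sigma$ assigns to every face a colour $0$ (white) or $1$ (black) so that no two faces sharing an edge are both black. Put $|\sigma_\chi|=8\sigma(F_0^\chi)+4\sigma(F_1^\chi)+2\sigma(F_2^\chi)+\sigma(F_3^\chi)$; in a state this lies in $\{0,1,2,4,5,8,10\}$. Let $R$ be a commutative ring with $16$ chosen elements $f_0,f_1$ and $x_i,X_i$ for $i\in\{0,1,2,4,5,8,10\}$. The monomial of $\sigma$ is the product of $X_{|\sigma_\chi|}$ over the positive crossings, $x_{|\sigma_\chi|}$ over the negative crossings, and $f_{\sigma(F)}$ over the faces $F$. The state sum $[D]\in R$ is the sum of the monomials of all states of $D$. \textbf{Moves.} \emph{Move 2a} (restricted form): in one diagram two strands, both going upwards, cross first at a positive crossing and then at a negative crossing, and these two crossings are the vertices of a bigonal face; the face above the upper crossing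 and the face below the lower crossing are distinct. In the other diagram the two crossings are removed, so that the strands run side by side; the rest is unchanged. \emph{Move 3a}: the third Reidemeister move on a triangular face with three distinct vertices whose edges are coherently oriented, running clockwise on one side of the move and counterclockwise on the other, two of its crossings being positive and one negative. Both diagrams of a move are assumed to be connected with at least one crossing. \textbf{Theorem.} Suppose that the 16 elements satisfy the following 25 equations. For move 2a: $$\begin{aligned} & f_0^3x_0X_0+f_0^2f_1X_2x_8=f_0, && f_0^2f_1x_0X_8+f_0f_1^2x_8X_{10}=0,\\ & f_0^3x_1X_1=f_0, && f_0^2f_1X_0x_2+f_0f_1^2X_2x_{10}=0,\\ & f_0f_1^2x_2X_8+f_1^3x_{10}X_{10}-f_1=0, && f_0^3x_4X_4=f_0,\\ & f_0^3x_5X_5=f_0. && \end{aligned}$$ For move 3a: $$\begin{aligned} & f_0x_0X_0^2+f_1x_1X_4^2=f_0x_0X_0^2+f_1x_1X_1^2, && f_0x_0X_0X_1+f_1x_1X_4X_5=f_0X_0X_2x_8,\\ & f_0X_0X_2x_8=f_0x_0X_0X_4+f_1x_1X_1X_5, && f_0X_0^2x_1+f_1X_4^2x_5=f_0x_0X_2X_8,\\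 & f_0X_0x_1X_1+f_1X_4x_5X_5=f_0X_2x_8X_{10}, && f_0X_0x_2X_8=f_0x_0X_0X_4+f_1x_1X_1X_5,\\ & f_0X_1x_2X_8=f_0X_2X_4x_8, && f_0X_2X_8x_{10}=f_0x_0X_4^2+f_1x_1X_5^2,\\ & f_0x_0X_0X_1+f_1x_4X_4X_5=f_0X_0x_2X_8, && f_0x_0X_1^2+f_1x_4X_5^2=f_0X_2X_8x_{10},\\ & f_0X_1X_2x_8=f_0x_2X_4X_8, && f_0X_0x_1X_1+f_1X_4x_5X_5=f_0x_2X_8X_{10},\\ & f_0x_1X_1^2+f_1x_5X_5^2=f_0x_{10}X_{10}^2, && f_0x_0X_2X_8=f_0X_0^2x_4+f_1X_1^2x_5,\\ & f_0X_2x_8X_{10}=f_0X_0x_4X_4+f_1X_1x_5X_5, && f_0x_1X_2X_8=f_0X_2x_4X_8,\\ & f_0x_2X_8X_{10}=f_0X_0x_4X_4+f_1X_1x_5X_5, && f_0x_{10}X_{10}^2=f_0x_4X_4^2+f_1x_5X_5^2. \end{aligned}$$ Then the state sum is invariant under moves 2a and 3a: if $D$ and $D'$ are related by one of these moves, then $[D]=[D']$.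 -/

import Mathlib

/-- The two sides of a crossing that is drawn with both of its strands going upwards. -/
inductive Side
  | left
  | right
  deriving DecidableEq

/-!
Picture of a crossing `v`, both strands oriented upwards. The four angles are numbered
counterclockwise, number `0` being the one between the two incoming ends:

          outgoing left    2    outgoing right
                        \     /
                     3     v     1
                        /     \
          incoming left    0    incoming right

The two strands join incoming left to outgoing right, and incoming right to outgoing left.
The connected 4-regular plane graph underlying a link diagram is encoded by its rotation system:
an edge is named by the outgoing end at which it starts, and `next` gives the incoming end at
which it arrives.
-/

/-- The combinatorial data of an oriented link diagram with set of crossings `V`: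
`next (v, s) = (u, t)` means that the edge leaving `v` through its outgoing end on side `s`
arrives at `u` through the incoming end on side `t`; `overIn v` is the side of the incoming end
of the over-strand at `v`. -/
structure OrientedCode (V : Type*) where
  next : V × Side ≃ V × Side
  overIn : V → Side

namespace OrientedCode

/-- The angle to the left of an outgoing end. -/
def outLeft : Side → Fin 4
  | Side.left => 3
  | Side.right => 2

/-- The angle to the right of an outgoing end. -/
def outRight : Side → Fin 4
  | Side.left => 2
  | Side.right => 1

/-- The angle to the left of an incoming end (looking in the direction of travel). -/
def inLeft : Side → Fin 4
  | Side.left => 3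
  | Side.right => 0

/-- The angle to the right of an incoming end (looking in the direction of travel). -/
def inRight : Side → Fin 4
  | Side.left => 0
  | Side.right => 1

variable {V : Type*} (D : OrientedCode V)

/-- Two angles of crossings are related when they are the two angles at the ends of an edge, on
the same side of that edge. -/
inductive AngleRel : V × Fin 4 → V × Fin 4 → Prop
  | onLeft (e : V × Side) :
      AngleRel (e.1, outLeft e.2) ((D.next e).1, inLeft (D.next e).2)
  | onRight (e : V × Side) :
      AngleRel (e.1, outRight e.2) ((D.next e).1, inRight (D.next e).2)

/-- The faces: classes of angles under the equivalence relation generated by `AngleRel`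
(going around the boundary of the face). -/
def Face : Type _ := Quot D.AngleRel

/-- The face containing the angle number `i` of the crossing `v`. -/
def face (v : V) (i : Fin 4) : D.Face := Quot.mk _ (v, i)

/-- The face to the left of an edge. -/
def leftFace (e : V × Side) : D.Face := D.face e.1 (outLeft e.2)

/-- The face to the right of an edge. -/
def rightFace (e : V × Side) : D.Face := D.face e.1 (outRight e.2)

instance [Finite V] : Finite D.Face := by
  unfold Face
  infer_instance

noncomputable instance [Finite V] : Fintype D.Face := Fintype.ofFinite _

/-- A crossing is positive when its over-strand goes from lower left to upper right. -/
def IsPositive (v : V) : Prop := D.overIn v = Side.left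

/-- A state: a map from the faces to `{0, 1}` such that two faces sharing an edge do not both
have image `1`. -/
def State : Type _ :=
  {σ : D.Face → Fin 2 // ∀ e : V × Side, ¬ (σ (D.leftFace e) = 1 ∧ σ (D.rightFace e) = 1)}

instance [Finite V] : Finite D.State := by
  unfold State
  infer_instance

noncomputable instance [Finite V] : Fintype D.State := Fintype.ofFinite _

/-- The value of the four bits at the crossing `v`, read as a binary number. -/
def bits (σ : D.State) (v : V) : ℕ :=
  8 * (σ.1 (D.face v 0)).val + 4 * (σ.1 (D.face v 1)).val
    + 2 * (σ.1 (D.face v 2)).val + (σ.1 (D.face v 3)).val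

end OrientedCode

/-- An adequate projection: a connected oriented link diagram in the plane with at least one
crossing. A connected code is the code of a plane diagram exactly when the Euler characteristic
`crossings - edges + faces` is `2`, where the number of edges is twice that of crossings. -/
structure LinkDiagram (V : Type*) extends OrientedCode V where
  nonempty : Nonempty V
  connected : ∀ u v : V,
    Relation.EqvGen (fun a b => ∃ s : Side, (next (a, s)).1 = b) u v
  planar : Nat.card toOrientedCode.Face = Nat.card V + 2

/-- Values in `R` of the 16 variables of the state sum. -/
structure Weights (R : Type*) where
  (f0 f1 : R)
  (x0 x1 x2 x4 x5 x8 x10 : R)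
  (X0 X1 X2 X4 X5 X8 X10 : R)

namespace Weights

variable {R : Type*} [CommRing R] (w : Weights R)

/-- The variable of a face of colour `0` (white) or `1` (black). -/
def faceVar (c : Fin 2) : R := if c = 0 then w.f0 else w.f1

/-- The variable `x_n` of a negative crossing (other values of `n` do not occur in states). -/
def negVar : ℕ → R
  | 0 => w.x0
  | 1 => w.x1
  | 2 => w.x2
  | 4 => w.x4
  | 5 => w.x5
  | 8 => w.x8
  | 10 => w.x10
  | _ => 0

/-- The variable `X_n` of a positive crossing (other values of `n` do not occur in states). -/
def posVar : ℕ → R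
  | 0 => w.X0
  | 1 => w.X1
  | 2 => w.X2
  | 4 => w.X4
  | 5 => w.X5
  | 8 => w.X8
  | 10 => w.X10
  | _ => 0

/-- The first 7 of the 25 equations. -/
def Equations2a : Prop :=
  w.f0 ^ 3 * w.x0 * w.X0 + w.f0 ^ 2 * w.f1 * w.X2 * w.x8 = w.f0 ∧
  w.f0 ^ 2 * w.f1 * w.x0 * w.X8 + w.f0 * w.f1 ^ 2 * w.x8 * w.X10 = 0 ∧
  w.f0 ^ 3 * w.x1 * w.X1 = w.f0 ∧
  w.f0 ^ 2 * w.f1 * w.X0 * w.x2 + w.f0 * w.f1 ^ 2 * w.X2 * w.x10 = 0 ∧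
  w.f0 * w.f1 ^ 2 * w.x2 * w.X8 + w.f1 ^ 3 * w.x10 * w.X10 - w.f1 = 0 ∧
  w.f0 ^ 3 * w.x4 * w.X4 = w.f0 ∧
  w.f0 ^ 3 * w.x5 * w.X5 = w.f0

/-- The last 18 of the 25 equations. -/
def Equations3a : Prop :=
  w.f0 * w.x0 * w.X0 ^ 2 + w.f1 * w.x1 * w.X4 ^ 2
    = w.f0 * w.x0 * w.X0 ^ 2 + w.f1 * w.x1 * w.X1 ^ 2 ∧
  w.f0 * w.x0 * w.X0 * w.X1 + w.f1 * w.x1 * w.X4 * w.X5 = w.f0 * w.X0 * w.X2 * w.x8 ∧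
  w.f0 * w.X0 * w.X2 * w.x8 = w.f0 * w.x0 * w.X0 * w.X4 + w.f1 * w.x1 * w.X1 * w.X5 ∧
  w.f0 * w.X0 ^ 2 * w.x1 + w.f1 * w.X4 ^ 2 * w.x5 = w.f0 * w.x0 * w.X2 * w.X8 ∧
  w.f0 * w.X0 * w.x1 * w.X1 + w.f1 * w.X4 * w.x5 * w.X5 = w.f0 * w.X2 * w.x8 * w.X10 ∧
  w.f0 * w.X0 * w.x2 * w.X8 = w.f0 * w.x0 * w.X0 * w.X4 + w.f1 * w.x1 * w.X1 * w.X5 ∧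
  w.f0 * w.X1 * w.x2 * w.X8 = w.f0 * w.X2 * w.X4 * w.x8 ∧
  w.f0 * w.X2 * w.X8 * w.x10 = w.f0 * w.x0 * w.X4 ^ 2 + w.f1 * w.x1 * w.X5 ^ 2 ∧
  w.f0 * w.x0 * w.X0 * w.X1 + w.f1 * w.x4 * w.X4 * w.X5 = w.f0 * w.X0 * w.x2 * w.X8 ∧
  w.f0 * w.x0 * w.X1 ^ 2 + w.f1 * w.x4 * w.X5 ^ 2 = w.f0 * w.X2 * w.X8 * w.x10 ∧
  w.f0 * w.X1 * w.X2 * w.x8 = w.f0 * w.x2 * w.X4 * w.X8 ∧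
  w.f0 * w.X0 * w.x1 * w.X1 + w.f1 * w.X4 * w.x5 * w.X5 = w.f0 * w.x2 * w.X8 * w.X10 ∧
  w.f0 * w.x1 * w.X1 ^ 2 + w.f1 * w.x5 * w.X5 ^ 2 = w.f0 * w.x10 * w.X10 ^ 2 ∧
  w.f0 * w.x0 * w.X2 * w.X8 = w.f0 * w.X0 ^ 2 * w.x4 + w.f1 * w.X1 ^ 2 * w.x5 ∧
  w.f0 * w.X2 * w.x8 * w.X10 = w.f0 * w.X0 * w.x4 * w.X4 + w.f1 * w.X1 * w.x5 * w.X5 ∧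
  w.f0 * w.x1 * w.X2 * w.X8 = w.f0 * w.X2 * w.x4 * w.X8 ∧
  w.f0 * w.x2 * w.X8 * w.X10 = w.f0 * w.X0 * w.x4 * w.X4 + w.f1 * w.X1 * w.x5 * w.X5 ∧
  w.f0 * w.x10 * w.X10 ^ 2 = w.f0 * w.x4 * w.X4 ^ 2 + w.f1 * w.x5 * w.X5 ^ 2

end Weights

namespace LinkDiagram

variable {V V' : Type*}

open Classical in
/-- The monomial of a state: the product of the variables at the crossings and at the faces. -/
noncomputable def monomial {R : Type*} [CommRing R] [Fintype V] (w : Weights R)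
    (D : LinkDiagram V) (σ : D.State) : R :=
  (∏ v : V, if D.IsPositive v then w.posVar (D.bits σ v) else w.negVar (D.bits σ v)) *
    ∏ F : D.Face, w.faceVar (σ.1 F)

/-- The state sum of a diagram. -/
noncomputable def stateSum {R : Type*} [CommRing R] [Fintype V] (w : Weights R)
    (D : LinkDiagram V) : R :=
  ∑ σ : D.State, D.monomial w σ

open Classical in
/-- The incoming end reached by an edge arriving at `f`, once the two crossings `a`, `b` of a
bigon, `a` below `b`, have been pulled apart: the strand that arrives at `a` on one side goes on
along the edge that leaves `b` on the same side. -/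
noncomputable def skipBigon (D : LinkDiagram V) (a b : V) (f : V × Side) : V × Side :=
  if f.1 = a then D.next (b, f.2) else f

/-- `D'` is obtained from `D` by the move 2a, in the restricted form. In `D` two strands going
upwards side by side cross at `a` (positive) and then again at `b` (negative), the two crossings
being the vertices of a bigonal face; the faces above `b` and below `a` are distinct. In `D'` the
two crossings are removed and the strands run side by side. -/
def IsMove2a (D : LinkDiagram V) (D' : LinkDiagram V') : Prop :=
  ∃ a b : V,
    D.IsPositive a ∧ ¬ D.IsPositive b ∧
    D.next (a, Side.left) = (b, Side.left) ∧ D.next (a, Side.right) = (b, Side.right) ∧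
    D.face b 2 ≠ D.face a 0 ∧
    ∃ ι : V' ≃ {v : V // v ≠ a ∧ v ≠ b},
      (∀ v, D'.overIn v = D.overIn (ι v)) ∧
      ∀ (v : V') (s : Side),
        (((ι (D'.next (v, s)).1 : V), (D'.next (v, s)).2) : V × Side)
          = D.skipBigon a b (D.next (ι v, s))

open Classical in
/-- Exchange of the outgoing ends under the move 3a (see `IsMove3a`). -/
noncomputable def swapOut (p q r : V) : Equiv.Perm (V × Side) :=
  Equiv.swap (p, Side.right) (q, Side.left) * Equiv.swap (q, Side.right) (r, Side.left) *
    Equiv.swap (r, Side.right) (p, Side.left)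

open Classical in
/-- Exchange of the incoming ends under the move 3a (see `IsMove3a`). -/
noncomputable def swapIn (p q r : V) : Equiv.Perm (V × Side) :=
  Equiv.swap (p, Side.left) (q, Side.right) * Equiv.swap (q, Side.left) (r, Side.right) *
    Equiv.swap (r, Side.left) (p, Side.right)

/-- `D'` is obtained from `D` by the move 3a. In `D` the distinct crossings `p`, `q`, `r` are the
vertices of a triangular face whose edges run clockwise, from `p` to `q` to `r` to `p`; the signs
of `p`, `q` are positive and that of `r` is negative. One strand is moved across the crossing of
the other two. In `D'` every crossing persists with its over- and under-strand, but each of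
the three strands meets its two crossings in the opposite order.

Consider the strand along the edge from `p` to `q`. In `D` it enters at `p` from the left, leaves
`p` on the right for `q`, which it enters from the right, and exits from `q` on the left. In `D'`
it enters at `q` from the right, leaves `q` on the left for `p`, which it enters from the left,
and exits from `p` on the right. So the places of the incoming ends `(p, left)`, `(q, right)` are
exchanged, and likewise those of the outgoing ends `(p, right)`, `(q, left)`; similarly for the
other two strands. In particular the triangle of `D'` has edges from `q` to `p` to `r` to `q`,
running counterclockwise. All edges outside stay as they are. -/
def IsMove3a (D : LinkDiagram V) (D' : LinkDiagram V') : Prop :=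
  ∃ p q r : V,
    p ≠ q ∧ q ≠ r ∧ p ≠ r ∧
    D.IsPositive p ∧ D.IsPositive q ∧ ¬ D.IsPositive r ∧
    D.next (p, Side.right) = (q, Side.right) ∧
    D.next (q, Side.right) = (r, Side.right) ∧
    D.next (r, Side.right) = (p, Side.right) ∧
    ∃ ε : V ≃ V',
      (∀ v, D'.overIn (ε v) = D.overIn v) ∧
      ∀ e : V × Side,
        D'.next (Prod.map ε id (swapOut p q r e)) = Prod.map ε id (swapIn p q r (D.next e))

end LinkDiagram

/-! Crossing variables vanish when an outgoing edge has black faces on both sides, so the state sum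
may be taken over all colourings of the faces (`stateSum_eq_sum_colourings`). Each move then reduces
to a local identity obtained by summing out the colours of the faces inside the move, with the
surrounding colours fixed.

Move 3a: the faces of the two diagrams correspond, triangle to triangle, and the sums over the
triangle's colour agree (`triangle_identity`) once multiplied by the variable of one neighbouring
face. That extra factor is needed because the all-white case follows from the equations only after
multiplication by `f0`, and it also uses an equation of move 2a.

Move 2a: the faces of `D` are those of `D'`, the bigon, and the face above the bigon, which in `D'`
is merged with the face below. Summing over the bigon's colour (`bigon_identity`) gives zero unless
the faces above and below have equal colours, and otherwise leaves the variable of the merged face.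

Planarity enters through Euler's formula: it fixes the number of faces, so the face correspondences
need only be shown surjective. -/

/-- Two sums over all functions agree if they agree after summing over the value at one point. -/
lemma Fintype.sum_fun_eq_of_sum_update_eq {α β R : Type*} [Fintype α] [DecidableEq α] [Fintype β]
    [AddCommMonoid R] (a : α) {f g : (α → β) → R}
    (h : ∀ τ, ∑ b, f (Function.update τ a b) = ∑ b, g (Function.update τ a b)) :
    ∑ τ, f τ = ∑ τ, g τ := by
  have key : ∀ f : (α → β) → R, ∑ τ, f τ =
      ∑ τ : {j // j ≠ a} → β, ∑ b, f ((Equiv.funSplitAt a β).symm (b, τ)) := by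
    intro f
    rw [← (Equiv.funSplitAt a β).symm.sum_comp, Fintype.sum_prod_type_right]
  rw [key f, key g]
  refine Finset.sum_congr rfl fun τ _ => ?_
  -- An arbitrary value `c` completes `τ` to a function on all of `α`; the update at `a` overwrites
  -- it.
  rcases isEmpty_or_nonempty β with hβ | ⟨⟨c⟩⟩
  · simp
  have e : ∀ b, (Equiv.funSplitAt a β).symm (b, τ) =
      Function.update ((Equiv.funSplitAt a β).symm (c, τ)) a b := by
    intro b
    ext j
    by_cases hj : j = a
    · subst hj; simp
    · rw [Function.update_of_ne hj]
      rw [Equiv.funSplitAt_symm_apply, Equiv.funSplitAt_symm_apply, dif_neg hj, dif_neg hj]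
  rw [Finset.sum_congr rfl fun b _ => congrArg f (e b),
    Finset.sum_congr rfl fun b _ => congrArg g (e b)]
  exact h _

/-! ### Local identities between the weights -/

namespace Weights

variable {R : Type*} [CommRing R] (w : Weights R)

/-- The variable of a crossing with over-strand entering on the given side, whose angles have the
given colours. -/
def crossVar : Side → Fin 2 → Fin 2 → Fin 2 → Fin 2 → R
  | Side.left, i, j, k, l => w.posVar (8 * i.val + 4 * j.val + 2 * k.val + l.val)
  | Side.right, i, j, k, l => w.negVar (8 * i.val + 4 * j.val + 2 * k.val + l.val)

/-- Angles 1, 2 flank the right outgoing end, and angles 2, 3 the left one. Every edge starts at an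
outgoing end, so these two vanishing statements detect every pair of adjacent black faces. -/
lemma crossVar_eq_zero_of_12 (s : Side) (i l : Fin 2) : w.crossVar s i 1 1 l = 0 := by
  cases s <;> fin_cases i <;> fin_cases l <;> rfl

lemma crossVar_eq_zero_of_23 (s : Side) (i j : Fin 2) : w.crossVar s i j 1 1 = 0 := by
  cases s <;> fin_cases i <;> fin_cases j <;> rfl

variable {w}

/-- The local form of invariance under the move 2a, for given colours of the faces around the
bigon. -/
lemma bigon_identity (h : w.Equations2a) (s n W E : Fin 2) (hW : ¬ (W = 1 ∧ s = 1))
    (hE : ¬ (s = 1 ∧ E = 1)) :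
    ∑ d : Fin 2, w.crossVar Side.left s E d W * w.crossVar Side.right d E n W *
      (w.faceVar d * (w.faceVar n * w.faceVar s)) = if n = s then w.faceVar s else 0 := by
  obtain ⟨h1, h2, h3, h4, h5, h6, h7⟩ := h
  rw [Fin.sum_univ_two]
  -- If `s` and one of `W`, `E` are black, the left side is 0, but for `n = s` the right side is
  -- `f1`; `hW` and `hE` remove these cases.
  fin_cases s <;> fin_cases n <;> fin_cases W <;> fin_cases E <;>
    simp [crossVar, posVar, negVar, faceVar] at hW hE ⊢ <;>
    first
    | linear_combination h1
    | linear_combination h2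
    | linear_combination h3
    | linear_combination h4
    | linear_combination h5
    | linear_combination h6
    | linear_combination h7

set_option maxHeartbeats 800000 in
/-- The local form of invariance under the move 3a, for given colours of the faces around the
triangle. -/
lemma triangle_identity (h2 : w.Equations2a) (h3 : w.Equations3a) (A B C P Q S : Fin 2) :
    w.faceVar A * ∑ t : Fin 2, w.faceVar t * (w.crossVar Side.left C t A P *
        w.crossVar Side.left A t B Q * w.crossVar Side.right B t C S) =
      w.faceVar A * ∑ t : Fin 2, w.faceVar t * (w.crossVar Side.left S B Q t *
        w.crossVar Side.left P C S t * w.crossVar Side.right Q A P t) := by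
  obtain ⟨-, -, -, -, -, -, g⟩ := h2
  obtain ⟨e1, e2, e3, e4, e5, e6, e7, e8, e9, e10, e11, e12, e13, e14, e15, e16, e17, e18⟩ := h3
  -- The all-white case needs `x4 * X4 ^ 2` where `e1` has `x1 * X4 ^ 2`. The combination of `e2`,
  -- `e9`, `e3`, `e6` says `f1 * X4 * X5 * (x1 - x4) = 0`; multiplying by `f0 ^ 3 * x5 * X4` and
  -- using `g` to remove `x5 * X5` costs one factor `f0`.
  have k : w.f0 * (w.f1 * w.x4 * w.X4 ^ 2) = w.f0 * (w.f1 * w.x1 * w.X1 ^ 2) := by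
    linear_combination w.f0 * e1 - w.f0 ^ 3 * w.x5 * w.X4 * (e2 - e9 + e3 - e6) +
      (w.f1 * w.X4 ^ 2 * (w.x1 - w.x4)) * g
  rw [Fin.sum_univ_two, Fin.sum_univ_two]
  -- Around the triangle the outer faces follow each other as `A, P, C, S, B, Q`. If two consecutive
  -- ones are black, both sides vanish; the 18 independent sets of this hexagon remain.
  fin_cases A <;> fin_cases B <;> fin_cases C <;> fin_cases P <;> fin_cases Q <;> fin_cases S <;>
    simp [crossVar, posVar, negVar, faceVar]
  · linear_combination k
  · linear_combination w.f0 * e4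
  -- Here only `Q` is black and the term `x4 * X4 * X5` is required, while `e2` has `x1 * X4 * X5`.
  -- Equation `e9` has the right left side, and `e6 - e3` corrects its right side.
  · linear_combination w.f0 * (e9 + e6 - e3)
  · linear_combination w.f0 * e5
  · linear_combination w.f0 * e9
  · linear_combination w.f0 * e12
  · linear_combination w.f0 * e10
  · linear_combination w.f0 * e13
  · linear_combination w.f0 * e6
  · linear_combination w.f0 * e7
  · linear_combination w.f0 * e3
  · linear_combination w.f0 * e11
  · linear_combination w.f0 * e8
  · linear_combination w.f1 * e14
  · linear_combination w.f1 * e16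
  · linear_combination w.f1 * e17
  · linear_combination w.f1 * e15
  · linear_combination w.f1 * e18

end Weights

/-! ### From states to arbitrary colourings -/

namespace OrientedCode

variable {V : Type*} (D : OrientedCode V)

/-- The product of the variables at the crossing `v`, for any colouring of the faces. -/
def vertexVar {R : Type*} [CommRing R] (w : Weights R) (σ : D.Face → Fin 2) (v : V) : R :=
  w.crossVar (D.overIn v) (σ (D.face v 0)) (σ (D.face v 1)) (σ (D.face v 2)) (σ (D.face v 3))

lemma face_outLeft (e : V × Side) :
    D.face e.1 (outLeft e.2) = D.face (D.next e).1 (inLeft (D.next e).2) :=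
  Quot.sound (AngleRel.onLeft e)

lemma face_outRight (e : V × Side) :
    D.face e.1 (outRight e.2) = D.face (D.next e).1 (inRight (D.next e).2) :=
  Quot.sound (AngleRel.onRight e)

lemma face_outLeft_of_next {v u : V} {s t : Side} (h : D.next (v, s) = (u, t)) :
    D.face v (outLeft s) = D.face u (inLeft t) := by
  simpa [h] using D.face_outLeft (v, s)

lemma face_outRight_of_next {v u : V} {s t : Side} (h : D.next (v, s) = (u, t)) :
    D.face v (outRight s) = D.face u (inRight t) := by
  simpa [h] using D.face_outRight (v, s)

/-- The crossing variable vanishes if an edge leaving the crossing has black faces on both sides. -/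
lemma vertexVar_eq_zero {R : Type*} [CommRing R] (w : Weights R) (σ : D.Face → Fin 2)
    (e : V × Side) (hl : σ (D.leftFace e) = 1) (hr : σ (D.rightFace e) = 1) :
    D.vertexVar w σ e.1 = 0 := by
  obtain ⟨v, s⟩ := e
  cases s <;> simp only [leftFace, rightFace, outLeft, outRight] at hl hr <;>
    simp only [vertexVar, hl, hr]
  · exact w.crossVar_eq_zero_of_23 _ _ _
  · exact w.crossVar_eq_zero_of_12 _ _ _

end OrientedCode

namespace LinkDiagram

open OrientedCode

variable {V V' : Type*}

/-- The state sum as a sum over all colourings of the faces. -/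
lemma stateSum_eq_sum_colourings {R : Type*} [CommRing R] [Fintype V]
    (w : Weights R) (D : LinkDiagram V) [DecidableEq D.Face] :
    D.stateSum w = ∑ σ : D.Face → Fin 2,
      (∏ v, D.vertexVar w σ v) * ∏ F, w.faceVar (σ F) := by
  classical
  have hsub : ∀ σ : D.State, D.monomial w σ =
      (∏ v, D.vertexVar w σ.1 v) * ∏ F, w.faceVar (σ.1 F) := by
    intro σ
    unfold monomial
    congr 1
    refine Finset.prod_congr rfl fun v _ => ?_
    unfold IsPositive vertexVar bits
    cases D.overIn v <;> simp [Weights.crossVar]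
  unfold stateSum
  simp_rw [hsub]
  refine Finset.sum_of_injOn (fun σ : D.State => σ.1) Subtype.val_injective.injOn
    (by simp) (fun σ _ hσ => ?_) (fun _ _ => rfl)
  -- A colouring that is not a state has an edge between two black faces, and the crossing where
  -- that edge starts contributes 0.
  have : ∃ e, σ (D.leftFace e) = 1 ∧ σ (D.rightFace e) = 1 := by
    by_contra! hne
    exact hσ ⟨⟨σ, fun e he => hne e he.1 he.2⟩, Finset.mem_coe.2 (Finset.mem_univ _), rfl⟩
  obtain ⟨e, hl, hr⟩ := this
  rw [Finset.prod_eq_zero (Finset.mem_univ e.1) (D.vertexVar_eq_zero w σ e hl hr), zero_mul]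

/-- Euler's formula in the form used below to turn surjections between sets of faces into
bijections. -/
lemma card_face [Fintype V] (D : LinkDiagram V) :
    Fintype.card D.Face = Fintype.card V + 2 := by
  have := D.planar
  rwa [Nat.card_eq_fintype_card, Nat.card_eq_fintype_card] at this

/-! ### Move 3a: correspondence of faces -/

open Classical in
/-- The effect of the move 3a on angles: the angle of the new diagram, at the crossings of the
triangle, that lies in the face corresponding to that of a given angle of the old diagram. -/
noncomputable def triangleAngle (p q r : V) (x : V × Fin 4) : V × Fin 4 :=
  if x.1 = p then ![(q, 1), (p, 3), (r, 1), (q, 0)] x.2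
  else if x.1 = q then ![(r, 1), (q, 3), (p, 1), (r, 0)] x.2
  else if x.1 = r then ![(p, 1), (r, 3), (q, 1), (p, 0)] x.2
  else x

lemma swapOut_apply {p q r : V} (hpq : p ≠ q) (hqr : q ≠ r) (hpr : p ≠ r) :
    swapOut p q r (p, Side.left) = (r, Side.right) ∧
    swapOut p q r (p, Side.right) = (q, Side.left) ∧
    swapOut p q r (q, Side.left) = (p, Side.right) ∧
    swapOut p q r (q, Side.right) = (r, Side.left) ∧
    swapOut p q r (r, Side.left) = (q, Side.right) ∧
    swapOut p q r (r, Side.right) = (p, Side.left) := by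
  simp [swapOut, Equiv.swap_apply_def, hpq, hqr, hpr, hpq.symm, hqr.symm, hpr.symm]

lemma swapIn_apply {p q r : V} (hpq : p ≠ q) (hqr : q ≠ r) (hpr : p ≠ r) :
    swapIn p q r (p, Side.left) = (q, Side.right) ∧
    swapIn p q r (p, Side.right) = (r, Side.left) ∧
    swapIn p q r (q, Side.left) = (r, Side.right) ∧
    swapIn p q r (q, Side.right) = (p, Side.left) ∧
    swapIn p q r (r, Side.left) = (p, Side.right) ∧
    swapIn p q r (r, Side.right) = (q, Side.left) := by
  simp [swapIn, Equiv.swap_apply_def, hpq, hqr, hpr, hpq.symm, hqr.symm, hpr.symm]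

lemma swapOut_apply_of_ne {p q r v : V} (hp : v ≠ p) (hq : v ≠ q) (hr : v ≠ r) (s : Side) :
    swapOut p q r (v, s) = (v, s) := by
  simp [swapOut, Equiv.swap_apply_def, hp, hq, hr]

lemma swapIn_apply_of_ne {p q r v : V} (hp : v ≠ p) (hq : v ≠ q) (hr : v ≠ r) (s : Side) :
    swapIn p q r (v, s) = (v, s) := by
  simp [swapIn, Equiv.swap_apply_def, hp, hq, hr]

section

variable {p q r : V}

lemma triangleAngle_p (i : Fin 4) :
    triangleAngle p q r (p, i) = ![(q, 1), (p, 3), (r, 1), (q, 0)] i := by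
  simp [triangleAngle]

lemma triangleAngle_q (hpq : p ≠ q) (i : Fin 4) :
    triangleAngle p q r (q, i) = ![(r, 1), (q, 3), (p, 1), (r, 0)] i := by
  simp [triangleAngle, hpq.symm]

lemma triangleAngle_r (hqr : q ≠ r) (hpr : p ≠ r) (i : Fin 4) :
    triangleAngle p q r (r, i) = ![(p, 1), (r, 3), (q, 1), (p, 0)] i := by
  simp [triangleAngle, hqr.symm, hpr.symm]

lemma triangleAngle_of_ne {v : V} (hp : v ≠ p) (hq : v ≠ q) (hr : v ≠ r) (i : Fin 4) :
    triangleAngle p q r (v, i) = (v, i) := by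
  simp [triangleAngle, hp, hq, hr]

end

/-- The edges of the triangle created by the move 3a. -/
lemma next_triangle {D : OrientedCode V} {D' : OrientedCode V'} {p q r : V}
    (hpq : p ≠ q) (hqr : q ≠ r) (hpr : p ≠ r)
    (h1 : D.next (p, Side.right) = (q, Side.right)) (h2 : D.next (q, Side.right) = (r, Side.right))
    (h3 : D.next (r, Side.right) = (p, Side.right)) (ε : V ≃ V')
    (hε : ∀ e : V × Side,
        D'.next (Prod.map ε id (swapOut p q r e)) = Prod.map ε id (swapIn p q r (D.next e))) :
    D'.next (ε q, Side.left) = (ε p, Side.left) ∧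
    D'.next (ε r, Side.left) = (ε q, Side.left) ∧
    D'.next (ε p, Side.left) = (ε r, Side.left) := by
  obtain ⟨-, o2, -, o4, -, o6⟩ := swapOut_apply hpq hqr hpr
  obtain ⟨-, i2, -, i4, -, i6⟩ := swapIn_apply hpq hqr hpr
  have e1 := hε (p, Side.right)
  have e2 := hε (q, Side.right)
  have e3 := hε (r, Side.right)
  rw [h1, o2, i4] at e1
  rw [h2, o4, i6] at e2
  rw [h3, o6, i2] at e3
  exact ⟨e1, e2, e3⟩

/-- The map on angles underlying the move 3a respects faces. -/
lemma face_triangleAngle_eq {D : OrientedCode V} {D' : OrientedCode V'} {p q r : V}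
    (hpq : p ≠ q) (hqr : q ≠ r) (hpr : p ≠ r)
    (h1 : D.next (p, Side.right) = (q, Side.right)) (h2 : D.next (q, Side.right) = (r, Side.right))
    (h3 : D.next (r, Side.right) = (p, Side.right)) (ε : V ≃ V')
    (hε : ∀ e : V × Side,
        D'.next (Prod.map ε id (swapOut p q r e)) = Prod.map ε id (swapIn p q r (D.next e)))
    {x y : V × Fin 4} (hxy : D.AngleRel x y) :
    D'.face (ε (triangleAngle p q r x).1) (triangleAngle p q r x).2 =
      D'.face (ε (triangleAngle p q r y).1) (triangleAngle p q r y).2 := by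
  obtain ⟨n1, n2, n3⟩ := next_triangle hpq hqr hpr h1 h2 h3 ε hε
  have l1 := D'.face_outLeft_of_next n1
  have l2 := D'.face_outLeft_of_next n2
  have l3 := D'.face_outLeft_of_next n3
  have r1 := D'.face_outRight_of_next n1
  have r2 := D'.face_outRight_of_next n2
  have r3 := D'.face_outRight_of_next n3
  simp only [outLeft, outRight, inLeft, inRight] at l1 l2 l3 r1 r2 r3
  obtain ⟨o1, o2, o3, o4, o5, o6⟩ := swapOut_apply hpq hqr hpr
  obtain ⟨i1, i2, i3, i4, i5, i6⟩ := swapIn_apply hpq hqr hpr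
  have tp := @triangleAngle_p V p q r
  have tq := @triangleAngle_q V p q r hpq
  have tr := @triangleAngle_r V p q r hqr hpr
  -- Away from the edges of the old triangle, the two sides of an end go to the two sides of the
  -- exchanged end. For outgoing ends one side matches only after a step along an edge of the new
  -- triangle (`r1`, `r2`, `r3`); for incoming ends (`hin`) the angles match exactly.
  have hout : ∀ e : V × Side, e ≠ (p, Side.right) → e ≠ (q, Side.right) → e ≠ (r, Side.right) →
      D'.face (ε (triangleAngle p q r (e.1, outLeft e.2)).1)
          (triangleAngle p q r (e.1, outLeft e.2)).2 =
        D'.face (ε (swapOut p q r e).1) (outLeft (swapOut p q r e).2) ∧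
      D'.face (ε (triangleAngle p q r (e.1, outRight e.2)).1)
          (triangleAngle p q r (e.1, outRight e.2)).2 =
        D'.face (ε (swapOut p q r e).1) (outRight (swapOut p q r e).2) := by
    rintro ⟨v, s⟩ ep eq er
    by_cases hp : v = p
    · subst hp
      cases s
      · simp [o1, tp, outLeft, outRight, r2]
      · exact absurd rfl ep
    by_cases hq : v = q
    · subst hq
      cases s
      · simp [o3, tq, outLeft, outRight, r3]
      · exact absurd rfl eq
    by_cases hr : v = r
    · subst hr
      cases s
      · simp [o5, tr, outLeft, outRight, r1]
      · exact absurd rfl er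
    simp [swapOut_apply_of_ne hp hq hr, triangleAngle_of_ne hp hq hr]
  have hin : ∀ e : V × Side, e ≠ (p, Side.right) → e ≠ (q, Side.right) → e ≠ (r, Side.right) →
      D'.face (ε (triangleAngle p q r (e.1, inLeft e.2)).1)
          (triangleAngle p q r (e.1, inLeft e.2)).2 =
        D'.face (ε (swapIn p q r e).1) (inLeft (swapIn p q r e).2) ∧
      D'.face (ε (triangleAngle p q r (e.1, inRight e.2)).1)
          (triangleAngle p q r (e.1, inRight e.2)).2 =
        D'.face (ε (swapIn p q r e).1) (inRight (swapIn p q r e).2) := by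
    rintro ⟨v, s⟩ ep eq er
    by_cases hp : v = p
    · subst hp
      cases s
      · simp [i1, tp, inLeft, inRight]
      · exact absurd rfl ep
    by_cases hq : v = q
    · subst hq
      cases s
      · simp [i3, tq, inLeft, inRight]
      · exact absurd rfl eq
    by_cases hr : v = r
    · subst hr
      cases s
      · simp [i5, tr, inLeft, inRight]
      · exact absurd rfl er
    simp [swapIn_apply_of_ne hp hq hr, triangleAngle_of_ne hp hq hr]
  have hnext : ∀ e : V × Side, D'.next (ε (swapOut p q r e).1, (swapOut p q r e).2) =
      (ε (swapIn p q r (D.next e)).1, (swapIn p q r (D.next e)).2) := fun e => hε e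
  have key : ∀ e : V × Side,
      D'.face (ε (triangleAngle p q r (e.1, outLeft e.2)).1)
          (triangleAngle p q r (e.1, outLeft e.2)).2 =
        D'.face (ε (triangleAngle p q r ((D.next e).1, inLeft (D.next e).2)).1)
          (triangleAngle p q r ((D.next e).1, inLeft (D.next e).2)).2 ∧
      D'.face (ε (triangleAngle p q r (e.1, outRight e.2)).1)
          (triangleAngle p q r (e.1, outRight e.2)).2 =
        D'.face (ε (triangleAngle p q r ((D.next e).1, inRight (D.next e).2)).1)
          (triangleAngle p q r ((D.next e).1, inRight (D.next e).2)).2 := by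
    intro e
    by_cases ep : e = (p, Side.right)
    · subst ep
      simp [h1, tp, tq, outLeft, outRight, inLeft, inRight, l1]
    by_cases eq : e = (q, Side.right)
    · subst eq
      simp [h2, tr, tq, outLeft, outRight, inLeft, inRight, l2]
    by_cases er : e = (r, Side.right)
    · subst er
      simp [h3, tr, tp, outLeft, outRight, inLeft, inRight, l3]
    obtain ⟨a1, a2⟩ := hout e ep eq er
    obtain ⟨b1, b2⟩ := hin (D.next e) (fun h => er (D.next.injective (h.trans h3.symm)))
      (fun h => ep (D.next.injective (h.trans h1.symm)))
      (fun h => eq (D.next.injective (h.trans h2.symm)))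
    rw [a1, a2, b1, b2]
    exact ⟨D'.face_outLeft_of_next (hnext e), D'.face_outRight_of_next (hnext e)⟩
  cases hxy with
  | onLeft e => exact (key e).1
  | onRight e => exact (key e).2

/-- The bijection between the faces of two diagrams related by the move 3a. -/
lemma exists_faceEquiv_triangle [Fintype V] [Fintype V'] {D : LinkDiagram V} {D' : LinkDiagram V'}
    {p q r : V} (hpq : p ≠ q) (hqr : q ≠ r) (hpr : p ≠ r)
    (h1 : D.next (p, Side.right) = (q, Side.right)) (h2 : D.next (q, Side.right) = (r, Side.right))
    (h3 : D.next (r, Side.right) = (p, Side.right)) (ε : V ≃ V')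
    (hε : ∀ e : V × Side,
        D'.next (Prod.map ε id (swapOut p q r e)) = Prod.map ε id (swapIn p q r (D.next e))) :
    ∃ φ : D.Face ≃ D'.Face, ∀ v i, φ (D.face v i) =
      D'.face (ε (triangleAngle p q r (v, i)).1) (triangleAngle p q r (v, i)).2 := by
  obtain ⟨n1, n2, n3⟩ := next_triangle hpq hqr hpr h1 h2 h3 ε hε
  have r1 := D'.face_outRight_of_next n1
  have r2 := D'.face_outRight_of_next n2
  have r3 := D'.face_outRight_of_next n3
  simp only [outRight, inRight] at r1 r2 r3
  let φ : D.Face → D'.Face := Quot.lift (fun x =>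
    D'.face (ε (triangleAngle p q r x).1) (triangleAngle p q r x).2)
    (fun x y hxy => face_triangleAngle_eq hpq hqr hpr h1 h2 h3 ε hε hxy)
  have hφ : ∀ v i, φ (D.face v i) =
      D'.face (ε (triangleAngle p q r (v, i)).1) (triangleAngle p q r (v, i)).2 :=
    fun _ _ => rfl
  -- Injectivity then follows by counting, as both diagrams have the same number of crossings and
  -- hence of faces.
  have surj : Function.Surjective φ := by
    rintro ⟨v', i⟩
    obtain ⟨v, rfl⟩ := ε.surjective v'
    change ∃ F, φ F = D'.face (ε v) i
    by_cases hp : v = p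
    · subst hp
      fin_cases i
      · exact ⟨D.face r 3, by simp [hφ, triangleAngle_r hqr hpr]⟩
      · exact ⟨D.face q 2, by simp [hφ, triangleAngle_q hpq]⟩
      · exact ⟨D.face q 3, by simp [hφ, triangleAngle_q hpq, r3]⟩
      · exact ⟨D.face v 1, by simp [hφ, triangleAngle_p]⟩
    by_cases hq : v = q
    · subst hq
      fin_cases i
      · exact ⟨D.face p 3, by simp [hφ, triangleAngle_p]⟩
      · exact ⟨D.face p 0, by simp [hφ, triangleAngle_p]⟩
      · exact ⟨D.face r 3, by simp [hφ, triangleAngle_r hqr hpr, r1]⟩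
      · exact ⟨D.face v 1, by simp [hφ, triangleAngle_q hpq]⟩
    by_cases hr : v = r
    · subst hr
      fin_cases i
      · exact ⟨D.face q 3, by simp [hφ, triangleAngle_q hpq]⟩
      · exact ⟨D.face p 2, by simp [hφ, triangleAngle_p]⟩
      · exact ⟨D.face p 3, by simp [hφ, triangleAngle_p, r2]⟩
      · exact ⟨D.face v 1, by simp [hφ, triangleAngle_r hqr hpr]⟩
    exact ⟨D.face v i, by simp [hφ, triangleAngle_of_ne hp hq hr]⟩
  refine ⟨Equiv.ofBijective φ ((Fintype.bijective_iff_surjective_and_card φ).2 ⟨surj, ?_⟩), hφ⟩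
  rw [card_face, card_face, Fintype.card_congr ε]

/-- The three angles inside a clockwise triangle make up a face. -/
lemma face_eq_triangle {D : OrientedCode V} {p q r : V}
    (h1 : D.next (p, Side.right) = (q, Side.right)) (h2 : D.next (q, Side.right) = (r, Side.right))
    (h3 : D.next (r, Side.right) = (p, Side.right)) {v : V} {i : Fin 4}
    (h : D.face v i = D.face p 1) : (v = p ∨ v = q ∨ v = r) ∧ i = 1 := by
  -- The predicate of being an inner angle of the triangle is constant along `AngleRel`, so it
  -- descends to faces and separates the triangle from all other angles.
  let T : V × Fin 4 → Prop := fun x => (x.1 = p ∨ x.1 = q ∨ x.1 = r) ∧ x.2 = 1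
  have hT : ∀ x y, D.AngleRel x y → T x = T y := by
    intro x y hxy
    cases hxy with
    | onLeft e =>
      have o : ∀ s, outLeft s ≠ 1 := by intro s; cases s <;> decide
      have i : ∀ s, inLeft s ≠ 1 := by intro s; cases s <;> decide
      simp [T, o, i]
    | onRight e =>
      have o : ∀ s, outRight s = 1 ↔ s = Side.right := by intro s; cases s <;> decide
      have i : ∀ s, inRight s = 1 ↔ s = Side.right := by intro s; cases s <;> decide
      have hl : T (e.1, outRight e.2) ↔
          e = (p, Side.right) ∨ e = (q, Side.right) ∨ e = (r, Side.right) := by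
        simp only [T, o, Prod.ext_iff]; tauto
      have hr : T ((D.next e).1, inRight (D.next e).2) ↔ D.next e = (p, Side.right) ∨
          D.next e = (q, Side.right) ∨ D.next e = (r, Side.right) := by
        simp only [T, i, Prod.ext_iff]; tauto
      have e1 : D.next e = (q, Side.right) ↔ e = (p, Side.right) := by
        rw [← h1, D.next.injective.eq_iff]
      have e2 : D.next e = (r, Side.right) ↔ e = (q, Side.right) := by
        rw [← h2, D.next.injective.eq_iff]
      have e3 : D.next e = (p, Side.right) ↔ e = (r, Side.right) := by
        rw [← h3, D.next.injective.eq_iff]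
      rw [hl, hr, e1, e2, e3, eq_iff_iff]
      exact or_rotate.symm
  have := congrArg (Quot.lift T hT) h
  change T (v, i) = T (p, 1) at this
  have hp : T (p, 1) := by simp [T]
  rw [← this] at hp
  exact hp

/-! ### Move 3a: comparison of the sums -/

/-- Invariance of the state sum under the move 3a. -/
theorem stateSum_eq_of_isMove3a {R : Type*} [CommRing R] {w : Weights R}
    (h2a : w.Equations2a) (h3a : w.Equations3a) [Fintype V] [Fintype V']
    {D : LinkDiagram V} {D' : LinkDiagram V'} (h : D.IsMove3a D') :
    D.stateSum w = D'.stateSum w := by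
  classical
  obtain ⟨p, q, r, hpq, hqr, hpr, sp, sq, sr, h1, h2, h3, ε, hover, hε⟩ := h
  obtain ⟨φ, hφ⟩ := exists_faceEquiv_triangle hpq hqr hpr h1 h2 h3 ε hε
  obtain ⟨n1, n2, n3⟩ := next_triangle hpq hqr hpr h1 h2 h3 ε hε
  have t1 := D.face_outRight_of_next h1
  have t3 := D.face_outRight_of_next h3
  have r1 := D'.face_outRight_of_next n1
  have r2 := D'.face_outRight_of_next n2
  have r3 := D'.face_outRight_of_next n3
  have u2 := D'.face_outLeft_of_next n2
  have u3 := D'.face_outLeft_of_next n3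
  simp only [outLeft, outRight, inLeft, inRight] at t1 t3 r1 r2 r3 u2 u3
  have hp : ∀ i, φ (D.face p i) = _ := fun i => (hφ p i).trans (by rw [triangleAngle_p])
  have hq : ∀ i, φ (D.face q i) = _ := fun i => (hφ q i).trans (by rw [triangleAngle_q hpq])
  have hr : ∀ i, φ (D.face r i) = _ := fun i => (hφ r i).trans (by rw [triangleAngle_r hqr hpr])
  have hT : φ (D.face p 1) = D'.face (ε p) 3 := hp 1
  -- No outer angle lies in the triangle, so recolouring the triangle changes no outer colour. The
  -- outer faces may coincide with one another: the local identity allows arbitrary colours.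
  have hne : ∀ v i, i ≠ 1 → φ (D.face v i) ≠ D'.face (ε p) 3 := fun v i hi hvi =>
    hi (face_eq_triangle h1 h2 h3 (φ.injective (hvi.trans hT.symm))).2
  have hne' : ∀ v i, v ≠ p → v ≠ q → v ≠ r → φ (D.face v i) ≠ D'.face (ε p) 3 :=
    fun v i hp hq hr hvi => by
      have := (face_eq_triangle h1 h2 h3 (φ.injective (hvi.trans hT.symm))).1
      tauto
  rw [stateSum_eq_sum_colourings, stateSum_eq_sum_colourings,
    ← (Equiv.arrowCongr φ (Equiv.refl (Fin 2))).symm.sum_comp]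
  refine Fintype.sum_fun_eq_of_sum_update_eq (D'.face (ε p) 3) fun τ => ?_
  have hvert : ∀ (c : Fin 2) (v : V), v ∈ ({p, q, r} : Finset V)ᶜ →
      D.vertexVar w ((Function.update τ (D'.face (ε p) 3) c) ∘ φ) v = D'.vertexVar w τ (ε v) ∧
      D'.vertexVar w (Function.update τ (D'.face (ε p) 3) c) (ε v) = D'.vertexVar w τ (ε v) := by
    intro c v hv
    simp only [Finset.mem_compl, Finset.mem_insert, Finset.mem_singleton, not_or] at hv
    obtain ⟨vp, vq, vr⟩ := hv
    have hv : ∀ i, φ (D.face v i) = D'.face (ε v) i := fun i =>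
      (hφ v i).trans (by rw [triangleAngle_of_ne vp vq vr])
    have hv' : ∀ i, D'.face (ε v) i ≠ D'.face (ε p) 3 := fun i => hv i ▸ hne' v i vp vq vr
    simp [vertexVar, hv, hv', hover]
  have split : ∀ f : V → R, ∏ v, f v = f p * f q * f r * ∏ v ∈ ({p, q, r} : Finset V)ᶜ, f v := by
    intro f
    rw [← Finset.prod_mul_prod_compl {p, q, r}, Finset.prod_insert (by simp [hpq, hpr]),
      Finset.prod_insert (by simp [hqr]), Finset.prod_singleton, ← mul_assoc (f p)]
  -- In `D` the faces `A`, `B`, `C` lie across the edges `pq`, `qr`, `rp`, and `P`, `Q`, `S` lie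
  -- opposite the vertices `p`, `q`, `r`. In `D'` these roles are interchanged; for instance, `A` is
  -- opposite `r`.
  have hA : D'.face (ε r) 1 ≠ D'.face (ε p) 3 := by simpa [hp] using hne p 2 (by decide)
  have hB : D'.face (ε p) 1 ≠ D'.face (ε p) 3 := by simpa [hq] using hne q 2 (by decide)
  have hC : D'.face (ε q) 1 ≠ D'.face (ε p) 3 := by simpa [hr] using hne r 2 (by decide)
  have hP : D'.face (ε q) 0 ≠ D'.face (ε p) 3 := by simpa [hp] using hne p 3 (by decide)
  have hQ : D'.face (ε r) 0 ≠ D'.face (ε p) 3 := by simpa [hq] using hne q 3 (by decide)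
  have hS : D'.face (ε p) 0 ≠ D'.face (ε p) 3 := by simpa [hr] using hne r 3 (by decide)
  -- Besides the triangle, the face `A` is split off, to supply the extra factor in
  -- `triangle_identity`.
  have hface : ∀ c, ∏ F, w.faceVar (Function.update τ (D'.face (ε p) 3) c F) =
      w.faceVar c * (w.faceVar (τ (D'.face (ε r) 1)) *
        ∏ F ∈ ({D'.face (ε p) 3, D'.face (ε r) 1} : Finset D'.Face)ᶜ, w.faceVar (τ F)) := by
    intro c
    rw [← Finset.prod_mul_prod_compl {D'.face (ε p) 3, D'.face (ε r) 1},
      Finset.prod_pair hA.symm, Function.update_self, Function.update_of_ne hA, mul_assoc]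
    congr 2
    refine Finset.prod_congr rfl fun F hF => ?_
    simp only [Finset.mem_compl, Finset.mem_insert, not_or] at hF
    rw [Function.update_of_ne hF.1]
  have op : D.overIn p = Side.left := sp
  have oq : D.overIn q = Side.left := sq
  have or : D.overIn r = Side.right := by
    cases hs : D.overIn r
    · exact absurd hs sr
    · rfl
  set M := ∏ F ∈ ({D'.face (ε p) 3, D'.face (ε r) 1} : Finset D'.Face)ᶜ, w.faceVar (τ F)
  set K := ∏ v ∈ ({p, q, r} : Finset V)ᶜ, D'.vertexVar w τ (ε v) with hK
  have hl : ∀ c, (∏ v, D.vertexVar w (Function.update τ (D'.face (ε p) 3) c ∘ φ) v) *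
      ∏ F, w.faceVar (Function.update τ (D'.face (ε p) 3) c (φ F)) =
      w.faceVar (τ (D'.face (ε r) 1)) * (w.faceVar c *
        (w.crossVar Side.left (τ (D'.face (ε q) 1)) c (τ (D'.face (ε r) 1)) (τ (D'.face (ε q) 0)) *
          w.crossVar Side.left (τ (D'.face (ε r) 1)) c (τ (D'.face (ε p) 1))
            (τ (D'.face (ε r) 0)) *
          w.crossVar Side.right (τ (D'.face (ε p) 1)) c (τ (D'.face (ε q) 1))
            (τ (D'.face (ε p) 0)))) * (M * K) := by
    intro c
    rw [φ.prod_comp (fun F => w.faceVar (Function.update τ (D'.face (ε p) 3) c F)), hface, split,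
      Finset.prod_congr rfl fun v hv => (hvert c v hv).1, ← hK]
    simp [vertexVar, op, oq, or, ← t1, t3, hT, hp, hq, hr, hA, hB, hC, hP, hQ, hS]
    ring
  have hr : ∀ c, (∏ v, D'.vertexVar w (Function.update τ (D'.face (ε p) 3) c) v) *
      ∏ F, w.faceVar (Function.update τ (D'.face (ε p) 3) c F) =
      w.faceVar (τ (D'.face (ε r) 1)) * (w.faceVar c *
        (w.crossVar Side.left (τ (D'.face (ε p) 0)) (τ (D'.face (ε p) 1)) (τ (D'.face (ε r) 0)) c *
          w.crossVar Side.left (τ (D'.face (ε q) 0)) (τ (D'.face (ε q) 1))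
            (τ (D'.face (ε p) 0)) c *
          w.crossVar Side.right (τ (D'.face (ε r) 0)) (τ (D'.face (ε r) 1))
            (τ (D'.face (ε q) 0)) c)) * (M * K) := by
    intro c
    rw [hface, ← ε.prod_comp, split, Finset.prod_congr rfl fun v hv => (hvert c v hv).2, ← hK]
    simp [vertexVar, hover, op, oq, or, ← u2, ← u3, r1, r2, r3, hA, hB, hC, hP, hQ, hS]
    ring
  refine (Finset.sum_congr rfl fun c _ => hl c).trans
    (Eq.trans ?_ (Finset.sum_congr rfl fun c _ => (hr c).symm))
  rw [← Finset.sum_mul, ← Finset.sum_mul, ← Finset.mul_sum, ← Finset.mul_sum,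
    Weights.triangle_identity h2a h3a]

/-! ### Move 2a: geometry of the bigon -/

/-- The geometric part of the move 2a: `a` and `b` are the lower and the upper vertex of a bigon of
`D`, and `D'` arises by pulling its two strands apart. -/
structure BigonData (D : LinkDiagram V) (D' : LinkDiagram V') (a b : V)
    (ι : V' ≃ {v : V // v ≠ a ∧ v ≠ b}) : Prop where
  left : D.next (a, Side.left) = (b, Side.left)
  right : D.next (a, Side.right) = (b, Side.right)
  ne : D.face b 2 ≠ D.face a 0
  next : ∀ (v : V') (s : Side),
    (((ι (D'.next (v, s)).1 : V), (D'.next (v, s)).2) : V × Side)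
      = D.skipBigon a b (D.next (ι v, s))

namespace BigonData

variable {D : LinkDiagram V} {D' : LinkDiagram V'} {a b : V}
  {ι : V' ≃ {v : V // v ≠ a ∧ v ≠ b}}

lemma next_ne_upper (h : BigonData D D' a b ι) {e : V × Side} (he : e.1 ≠ a) :
    (D.next e).1 ≠ b := by
  intro hb
  obtain ⟨v, s⟩ := e
  rcases hn : D.next (v, s) with ⟨u, t⟩
  rw [hn] at hb
  obtain rfl : u = b := hb
  cases t
  · exact he (congrArg Prod.fst (D.next.injective (hn.trans h.left.symm)))
  · exact he (congrArg Prod.fst (D.next.injective (hn.trans h.right.symm)))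

lemma lower_ne_upper (h : BigonData D D' a b ι) : a ≠ b := by
  rintro rfl
  exact h.ne (D.face_outRight_of_next h.left)

lemma next_lower_fst (h : BigonData D D' a b ι) (s : Side) : (D.next (a, s)).1 = b := by
  cases s
  · rw [h.left]
  · rw [h.right]

/-- The edges leaving the upper crossing of the bigon do not arrive at its lower crossing. -/
lemma next_upper_ne (h : BigonData D D' a b ι) (s : Side) : (D.next (b, s)).1 ≠ a := by
  intro hs
  -- A return to the same side would identify the faces above and below the bigon.
  have hne : ∀ s, D.next (b, s) ≠ (a, s) := by
    rintro (_ | _) hs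
    · exact h.ne (D.face_outRight_of_next hs)
    · exact h.ne (D.face_outLeft_of_next hs)
  obtain ⟨e, he⟩ := D.next.surjective (a, s)
  have hea : e.1 ≠ a := fun hea => h.lower_ne_upper <| by
    rw [← h.next_lower_fst e.2, ← hea, Prod.mk.eta, he]
    exact hea
  by_cases heb : e.1 = b
  · have hout : ∀ s, (D.next (b, s)).1 = a := by
      have h2 : e.2 ≠ s := fun h2 => hne s (by rw [← h2, ← heb, Prod.mk.eta, he, ← h2])
      intro t
      by_cases hts : t = s
      · rw [hts, hs]
      · have : t = e.2 := by
          revert hts h2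
          cases t <;> cases e.2 <;> cases s <;> simp
        rw [this, ← heb, Prod.mk.eta, he]
    have hin : ∀ e : V × Side, (D.next e).1 = a → e.1 = b := by
      intro e' he'
      by_contra hb
      -- Pigeonhole: a third edge into `a` would give three edges for two incoming ends.
      have hinj : Function.Injective fun o : Option Side =>
          (D.next (o.elim e' fun s => (b, s))).2 := by
        intro o o' hoo
        have h1 : (D.next (o.elim e' fun s => (b, s))).1 = a := by
          cases o <;> simp [he', hout]
        have h2 : (D.next (o'.elim e' fun s => (b, s))).1 = a := by
          cases o' <;> simp [he', hout]
        have := D.next.injective (Prod.ext (h1.trans h2.symm) hoo)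
        cases o <;> cases o' <;> simp_all [Prod.ext_iff]
      have : Fintype Side := ⟨{Side.left, Side.right}, fun s => by cases s <;> simp⟩
      have hlt := Fintype.card_le_of_injective _ hinj
      simp at hlt
    have hclosed : ∀ u v : V, Relation.EqvGen (fun x y => ∃ s : Side, (D.next (x, s)).1 = y) u v →
        ((u = a ∨ u = b) ↔ (v = a ∨ v = b)) := by
      intro u v huv
      induction huv with
      | rel x y hxy =>
        obtain ⟨s, rfl⟩ := hxy
        constructor
        · rintro (rfl | rfl)
          · exact Or.inr (h.next_lower_fst s)
          · exact Or.inl (hout s)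
        · rintro (hx | hx)
          · exact Or.inr (hin _ hx)
          · exact Or.inl (by_contra fun hne => h.next_ne_upper (e := (x, s)) hne hx)
      | refl => rfl
      | symm _ _ _ ih => exact ih.symm
      | trans _ _ _ _ _ ih1 ih2 => exact ih1.trans ih2
    -- A crossing of `D'` is a crossing of `D` outside `{a, b}`, against connectedness of `D`.
    obtain ⟨v⟩ := D'.nonempty
    have := (hclosed a (ι v) (D.connected _ _)).1 (Or.inl rfl)
    have hv := (ι v).2
    tauto
  -- An edge from outside that enters `a` on side `s` would continue in `D'` to the removed crossing
  -- `a`.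
  · have := h.next (ι.symm ⟨e.1, hea, heb⟩) e.2
    simp only [Equiv.apply_symm_apply, Prod.mk.eta, he, skipBigon, if_true] at this
    have h1 := congrArg Prod.fst this
    exact (ι _).2.1 (h1.trans hs)

/-- The edges arriving at the lower crossing of the bigon come from outside. -/
lemma exists_next_lower (h : BigonData D D' a b ι) (t : Side) :
    ∃ (v : V') (s : Side), D.next (ι v, s) = (a, t) := by
  obtain ⟨e, he⟩ := D.next.surjective (a, t)
  have hea : e.1 ≠ a := fun hea => h.lower_ne_upper <| by
    rw [← h.next_lower_fst e.2, ← hea, Prod.mk.eta, he]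
    exact hea
  have heb : e.1 ≠ b := fun heb => h.next_upper_ne e.2 <| by
    rw [← heb, Prod.mk.eta, he]
  exact ⟨ι.symm ⟨e.1, hea, heb⟩, e.2, by simpa using he⟩

open Classical in
/-- The face of `D` given by a face of `D'`; of the two faces above and below the bigon, which
become one face of `D'`, the lower one is taken. -/
noncomputable def faceMap (h : BigonData D D' a b ι) : D'.Face → D.Face :=
  Quot.lift (fun x =>
    if D.face (ι x.1) x.2 = D.face b 2 then D.face a 0 else D.face (ι x.1) x.2) <| by
    have l1 := D.face_outLeft_of_next h.left
    have r2 := D.face_outRight_of_next h.right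
    simp only [outLeft, outRight, inLeft, inRight] at l1 r2
    -- An edge of `D'` is an edge of `D` or a strand through the bigon. In the second case its outer
    -- side stays in one face, while its inner side starts in the face below and ends in the face
    -- above.
    have key : ∀ e : V' × Side,
        (D.face (ι e.1) (outLeft e.2) =
            D.face (ι (D'.next e).1) (inLeft (D'.next e).2) ∨
          D.face (ι e.1) (outLeft e.2) = D.face a 0 ∧
            D.face (ι (D'.next e).1) (inLeft (D'.next e).2) = D.face b 2) ∧
        (D.face (ι e.1) (outRight e.2) =
            D.face (ι (D'.next e).1) (inRight (D'.next e).2) ∨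
          D.face (ι e.1) (outRight e.2) = D.face a 0 ∧
            D.face (ι (D'.next e).1) (inRight (D'.next e).2) = D.face b 2) := by
      rintro ⟨v, s⟩
      have hn := h.next v s
      rcases hf : D.next (ι v, s) with ⟨u, t⟩
      have hl := D.face_outLeft_of_next hf
      have hr := D.face_outRight_of_next hf
      rw [hf, skipBigon] at hn
      by_cases hu : u = a
      · subst hu
        rw [if_pos rfl] at hn
        have hl' := D.face_outLeft_of_next hn.symm
        have hr' := D.face_outRight_of_next hn.symm
        cases t <;> simp only [outLeft, outRight, inLeft, inRight] at hl hr hl' hr' ⊢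
        · exact ⟨Or.inl (hl.trans (l1.trans hl')), Or.inr ⟨hr, hr'.symm⟩⟩
        · exact ⟨Or.inr ⟨hl, hl'.symm⟩, Or.inl (hr.trans (r2.trans hr'))⟩
      · rw [if_neg hu] at hn
        simp only [Prod.mk.injEq] at hn
        rw [hn.1, hn.2]
        exact ⟨Or.inl hl, Or.inl hr⟩
    intro x y hxy
    cases hxy with
    | onLeft e =>
      rcases (key e).1 with hk | ⟨hk, hk'⟩
      · simp only [hk]
      · simp only [hk, hk', if_true, ite_self]
    | onRight e =>
      rcases (key e).2 with hk | ⟨hk, hk'⟩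
      · simp only [hk]
      · simp only [hk, hk', if_true, ite_self]

/-- An angle at a crossing outside the bigon belongs to the face above the bigon or to the face
given by its face in `D'`. -/
lemma face_eq_or (h : BigonData D D' a b ι) (v : V') (i : Fin 4) :
    D.face (ι v) i = D.face b 2 ∧ h.faceMap (D'.face v i) = D.face a 0 ∨
      D.face (ι v) i = h.faceMap (D'.face v i) := by
  classical
  have : h.faceMap (D'.face v i) =
      if D.face (ι v) i = D.face b 2 then D.face a 0 else D.face (ι v) i := by
    unfold faceMap; rfl
  rw [this]
  by_cases hF : D.face (ι v) i = D.face b 2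
  · rw [if_pos hF]; exact Or.inl ⟨hF, rfl⟩
  · rw [if_neg hF]; exact Or.inr rfl

/-- The faces of `D` are the bigon, the face above it, and those given by faces of `D'`. -/
lemma exists_faceEquiv [Fintype V] [Fintype V'] (h : BigonData D D' a b ι) :
    ∃ φ : Option (Option D'.Face) ≃ D.Face, φ none = D.face a 2 ∧ φ (some none) = D.face b 2 ∧
      ∀ F, φ (some (some F)) = h.faceMap F := by
  classical
  let φ : Option (Option D'.Face) → D.Face := fun o =>
    o.elim (D.face a 2) fun o => o.elim (D.face b 2) h.faceMap
  have hout : ∀ v i, ∃ o, φ o = D.face (ι v) i := by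
    intro v i
    rcases h.face_eq_or v i with ⟨hF, -⟩ | hF
    · exact ⟨some none, hF.symm⟩
    · exact ⟨some (some (D'.face v i)), hF.symm⟩
  have l1 := D.face_outLeft_of_next h.left
  have r1 := D.face_outRight_of_next h.left
  have r2 := D.face_outRight_of_next h.right
  obtain ⟨vl, sl, hl⟩ := h.exists_next_lower Side.left
  obtain ⟨vr, sr, hr⟩ := h.exists_next_lower Side.right
  have hll := D.face_outLeft_of_next hl
  have hlr := D.face_outRight_of_next hl
  have hrr := D.face_outRight_of_next hr
  simp only [outLeft, outRight, inLeft, inRight] at l1 r1 r2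
  simp only [inLeft, inRight] at hll hlr hrr
  -- Surjectivity again suffices: `D` has two more crossings than `D'`, hence two more faces.
  have surj : Function.Surjective φ := by
    rintro ⟨v, i⟩
    change ∃ o, φ o = D.face v i
    by_cases ha : v = a
    · subst ha
      fin_cases i
      · exact hlr ▸ hout vl _
      · exact hrr ▸ hout vr _
      · exact ⟨none, rfl⟩
      · exact hll ▸ hout vl _
    by_cases hb : v = b
    · subst hb
      fin_cases i
      · exact ⟨none, r1⟩
      · exact r2 ▸ hrr ▸ hout vr _
      · exact ⟨some none, rfl⟩
      · exact l1 ▸ hll ▸ hout vl _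
    have := hout (ι.symm ⟨v, ha, hb⟩) i
    rwa [Equiv.apply_symm_apply] at this
  refine ⟨Equiv.ofBijective φ ((Fintype.bijective_iff_surjective_and_card φ).2 ⟨surj, ?_⟩),
    rfl, rfl, fun _ => rfl⟩
  have hc : Fintype.card V' + 2 = Fintype.card V := by
    rw [Fintype.card_congr ι, Fintype.card_subtype]
    have : (Finset.univ.filter fun v => v ≠ a ∧ v ≠ b) = ({a, b} : Finset V)ᶜ := by
      ext; simp
    rw [this, Finset.card_compl, Finset.card_pair h.lower_ne_upper]
    have := Finset.card_le_univ ({a, b} : Finset V)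
    rw [Finset.card_pair h.lower_ne_upper] at this
    omega
  rw [Fintype.card_option, Fintype.card_option, card_face, card_face]
  omega

end BigonData

/-! ### Move 2a: comparison of the sums -/

/-- The colouring of the option type with the given colours. -/
def optionColouring {α β : Type*} (d n : β) (τ : α → β) : Option (Option α) → β
  | none => d
  | some none => n
  | some (some x) => τ x

lemma sum_optionColouring {α β R : Type*} [Fintype α] [DecidableEq α] [Fintype β]
    [AddCommMonoid R] (f : (Option (Option α) → β) → R) :
    ∑ ρ, f ρ = ∑ τ : α → β, ∑ n, ∑ d, f (optionColouring d n τ) := by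
  let e : (β × β) × (α → β) ≃ (Option (Option α) → β) :=
    { toFun := fun x => optionColouring x.1.1 x.1.2 x.2
      invFun := fun ρ => ((ρ none, ρ (some none)), fun x => ρ (some (some x)))
      left_inv := fun _ => rfl
      right_inv := fun ρ => by
        funext o
        rcases o with _ | _ | _ <;> rfl }
  rw [← e.sum_comp, Fintype.sum_prod_type_right]
  exact Finset.sum_congr rfl fun τ _ => Fintype.sum_prod_type_right _

/-- Invariance of the state sum under the move 2a. -/
theorem stateSum_eq_of_isMove2a {R : Type*} [CommRing R] {w : Weights R}
    (h2a : w.Equations2a) [Fintype V] [Fintype V']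
    {D : LinkDiagram V} {D' : LinkDiagram V'} (h : D.IsMove2a D') :
    D.stateSum w = D'.stateSum w := by
  classical
  obtain ⟨a, b, sa, sb, hleft, hright, hne, ι, hover, hnext⟩ := h
  have h : BigonData D D' a b ι := ⟨hleft, hright, hne, hnext⟩
  have oa : D.overIn a = Side.left := sa
  have ob : D.overIn b = Side.right := by
    cases hs : D.overIn b
    · exact absurd hs sb
    · rfl
  obtain ⟨φ, φd, φn, hφ⟩ := h.exists_faceEquiv
  have l1 := D.face_outLeft_of_next h.left
  have r1 := D.face_outRight_of_next h.left
  have r2 := D.face_outRight_of_next h.right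
  obtain ⟨vl, sl, hl⟩ := h.exists_next_lower Side.left
  obtain ⟨vr, sr, hr⟩ := h.exists_next_lower Side.right
  have hll := D.face_outLeft_of_next hl
  have hlr := D.face_outRight_of_next hl
  have hrl := D.face_outLeft_of_next hr
  have hrr := D.face_outRight_of_next hr
  simp only [outLeft, outRight, inLeft, inRight] at l1 r1 r2
  simp only [inLeft, inRight] at hll hlr hrl hrr
  -- `S` is the merged face of `D'`, found to the right of the edge that enters the bigon from the
  -- lower left.
  obtain ⟨S, hS⟩ : ∃ S, h.faceMap S = D.face a 0 := by
    refine ⟨D'.face vl (outRight sl), ?_⟩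
    rcases h.face_eq_or vl (outRight sl) with hF | hF
    · exact hF.2
    · rw [← hF, hlr]
  have hout : ∀ v i, D.face (ι v) i = φ (some none) ∧ D'.face v i = S ∨
      D.face (ι v) i = φ (some (some (D'.face v i))) := by
    intro v i
    rcases h.face_eq_or v i with hF | hF
    · refine Or.inl ⟨hF.1.trans φn.symm, ?_⟩
      have := hF.2.trans hS.symm
      rw [← hφ, ← hφ] at this
      simpa using φ.injective this
    · exact Or.inr (hF.trans (hφ _).symm)
  rw [stateSum_eq_sum_colourings, stateSum_eq_sum_colourings,
    ← (Equiv.arrowCongr φ (Equiv.refl (Fin 2))).sum_comp, sum_optionColouring]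
  refine Finset.sum_congr rfl fun τ _ => ?_
  change ∑ n, ∑ d, (∏ v, D.vertexVar w (optionColouring d n τ ∘ φ.symm) v) *
    ∏ F, w.faceVar (optionColouring d n τ (φ.symm F)) = _
  have cd : ∀ d n, optionColouring d n τ (φ.symm (D.face a 2)) = d := by
    intro d n; rw [← φd, φ.symm_apply_apply]; rfl
  have cn : ∀ d n, optionColouring d n τ (φ.symm (D.face b 2)) = n := by
    intro d n; rw [← φn, φ.symm_apply_apply]; rfl
  have cS : ∀ d n, optionColouring d n τ (φ.symm (D.face a 0)) = τ S := by
    intro d n; rw [← hS, ← hφ, φ.symm_apply_apply]; rfl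
  have cout : ∀ d n v i, optionColouring d n τ (φ.symm (D.face (ι v) i)) =
      optionColouring 0 n τ (φ.symm (D.face (ι v) i)) := by
    intro d n v i
    rcases hout v i with ⟨hF, -⟩ | hF <;> rw [hF, φ.symm_apply_apply] <;> rfl
  have cout' : ∀ v i, optionColouring 0 (τ S) τ (φ.symm (D.face (ι v) i)) = τ (D'.face v i) := by
    intro v i
    rcases hout v i with ⟨hF, hF'⟩ | hF <;> rw [hF, φ.symm_apply_apply]
    · rw [hF']; rfl
    · rfl
  have cW : ∀ d n, optionColouring d n τ (φ.symm (D.face a 3)) =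
      optionColouring 0 n τ (φ.symm (D.face a 3)) := by
    intro d n; rw [← hll, cout]
  have cE : ∀ d n, optionColouring d n τ (φ.symm (D.face a 1)) =
      optionColouring 0 n τ (φ.symm (D.face a 1)) := by
    intro d n; rw [← hrr, cout]
  have hface : ∀ d n, ∏ F, w.faceVar (optionColouring d n τ (φ.symm F)) =
      w.faceVar d * (w.faceVar n * ∏ F, w.faceVar (τ F)) := by
    intro d n
    rw [φ.symm.prod_comp (fun o => w.faceVar (optionColouring d n τ o)), Fintype.prod_option,
      Fintype.prod_option]
    rfl
  have hvert : ∀ d n, ∏ v, D.vertexVar w (optionColouring d n τ ∘ φ.symm) v =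
      D.vertexVar w (optionColouring d n τ ∘ φ.symm) a *
        D.vertexVar w (optionColouring d n τ ∘ φ.symm) b *
        ∏ v, D.vertexVar w (optionColouring 0 n τ ∘ φ.symm) (ι v) := by
    intro d n
    rw [← Finset.prod_mul_prod_compl {a, b}, Finset.prod_pair h.lower_ne_upper]
    congr 1
    rw [Finset.prod_subtype (p := fun v => v ≠ a ∧ v ≠ b) _ (by simp), ← ι.prod_comp]
    exact Finset.prod_congr rfl fun v _ => by
      simp only [vertexVar, Function.comp_apply, cout d n]
  set M := ∏ F ∈ ({S} : Finset D'.Face)ᶜ, w.faceVar (τ F) with hM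
  have hfaceS : ∏ F, w.faceVar (τ F) = w.faceVar (τ S) * M := by
    rw [← Finset.prod_mul_prod_compl {S}, Finset.prod_singleton]
  have hterm : ∀ n, ∑ d, (∏ v, D.vertexVar w (optionColouring d n τ ∘ φ.symm) v) *
      ∏ F, w.faceVar (optionColouring d n τ (φ.symm F)) =
      if n = τ S then
        (∏ v, D.vertexVar w (optionColouring 0 n τ ∘ φ.symm) (ι v)) * (w.faceVar (τ S) * M)
      else 0 := by
    intro n
    set W := optionColouring 0 n τ (φ.symm (D.face a 3)) with hW
    set E := optionColouring 0 n τ (φ.symm (D.face a 1)) with hE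
    have hd : ∀ d, (∏ v, D.vertexVar w (optionColouring d n τ ∘ φ.symm) v) *
      ∏ F, w.faceVar (optionColouring d n τ (φ.symm F)) =
        (w.crossVar Side.left (τ S) E d W * w.crossVar Side.right d E n W *
          (w.faceVar d * (w.faceVar n * w.faceVar (τ S)))) *
        ((∏ v, D.vertexVar w (optionColouring 0 n τ ∘ φ.symm) (ι v)) * M) := by
      intro d
      rw [hvert, hface, hfaceS]
      simp only [vertexVar, Function.comp_apply, oa, ob, ← r1, ← l1, ← r2, cd, cn, cS, cW, cE]
      rw [← hW, ← hE]
      ring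
    rw [Finset.sum_congr rfl fun d _ => hd d, ← Finset.sum_mul]
    -- In the colourings excluded from `bigon_identity`, the edge entering the bigon from `vl` (or
    -- `vr`) has black faces on both sides, so the common factor from the outer crossings is 0.
    by_cases hWS : W = 1 ∧ τ S = 1
    · rw [Finset.prod_eq_zero (Finset.mem_univ vl)]
      · simp
      · refine D.vertexVar_eq_zero w _ ((ι vl : V), sl) ?_ ?_
        · simp only [leftFace, hll, Function.comp_apply]; exact hWS.1
        · simp only [rightFace, hlr, Function.comp_apply, cS]; exact hWS.2
    by_cases hES : τ S = 1 ∧ E = 1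
    · rw [Finset.prod_eq_zero (Finset.mem_univ vr)]
      · simp
      · refine D.vertexVar_eq_zero w _ ((ι vr : V), sr) ?_ ?_
        · simp only [leftFace, hrl, Function.comp_apply, cS]; exact hES.1
        · simp only [rightFace, hrr, Function.comp_apply]; exact hES.2
    rw [Weights.bigon_identity h2a _ _ _ _ hWS hES, ite_mul, zero_mul]
    congr 1
    ring
  rw [Finset.sum_congr rfl fun n _ => hterm n, Finset.sum_ite_eq', if_pos (Finset.mem_univ _),
    hfaceS]
  congr 1
  refine Finset.prod_congr rfl fun v _ => ?_
  simp only [vertexVar, Function.comp_apply, cout', hover]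

end LinkDiagram

theorem mainTheorem2 {R : Type*} [CommRing R] (w : Weights R)
    (h2a : w.Equations2a) (h3a : w.Equations3a) {V V' : Type*} [Fintype V] [Fintype V']
    (D : LinkDiagram V) (D' : LinkDiagram V') :
    (D.IsMove2a D' → D.stateSum w = D'.stateSum w) ∧
      (D.IsMove3a D' → D.stateSum w = D'.stateSum w) :=
  ⟨LinkDiagram.stateSum_eq_of_isMove2a h2a, LinkDiagram.stateSum_eq_of_isMove3a h2a h3a⟩
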